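/- **Theorem (discrete Stokes phenomenon).** Let $q>1$ be real and $p=1/q$. Put $$\theta_p(z)=\sum_{n\in\mathbb Z}p^{n(n-1)/2}z^n\quad(z\neq0),\qquad e_q(z)=\prod_{k\ge0}\bigl(1+(1-p)p^kz\bigr).$$ For $\lambda\in\mathbb C^*\smallsetminus\bigl(-(1-p)q^{\mathbb Z}\bigr)$ and $x\in\mathbb C^*\smallsetminus(-\lambda q^{\mathbb Z})$, the discrete $q$-Borel sum of the $q$-Euler series $\sum_{n\ge0}(-1)^n[n]_q^!\,x^{n+1}$ along $[\lambda]=\lambda q^{\mathbb Z}$ is $$\mathcal E_q^{[\lambda]}(x)=\frac{q}{1-p}\int_{\lambda p^{\mathbb Z}}\frac{1}{\left(1+\frac{\xi}{1-p}\right)e_q\!\left(\frac{q\,\xi}{(1-p)x}\right)}\,d_p\xi ,$$ where $\int_{\lambda p^{\mathbb Z}}f(\xi)\,d_p\xi$ is the Jackson integral, i.e. the limit of $\int_0^y f\,d_p\xi=(1-p)\,y\sum_{n\ge0}f(p^ny)p^n$ as $|y|\to\infty$, $y\in\lambda p^{\mathbb Z}$. Set $$K(a,b,x)=C\,\frac{\theta_p\!\left(-\frac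 ab\right)\theta_p\!\left(-\frac{1-p}{x}\right)\theta_p\!\left(-\frac{(1-p)ab}{x}\right)}{\theta_p(a)\,\theta_p(pb)\,\theta_p\!\left(\frac{(1-p)a}{x}\right)\theta_p\!\left(\frac{(1-p)b}{x}\right)} .$$ There is a constant $C\in\mathbb C$ depending only on $q$ such that, for all $\lambda,\mu\in\mathbb C^*\smallsetminus\bigl(-(1-p)q^{\mathbb Z}\bigr)$ and all $x\in\mathbb C^*\smallsetminus\bigl(-\lambda q^{\mathbb Z}\cup-\mu q^{\mathbb Z}\bigr)$, the Jackson integrals defining $\mathcal E_q^{[\lambda]}(x)$ and $\mathcal E_q^{[\mu]}(x)$ converge and $$\mathcal E_q^{[\lambda]}(x)-\mathcal E_q^{[\mu]}(x)=\frac{K\!\left(\frac{\lambda}{1-p},\frac{\mu}{1-p},x\right)}{e_q\!\left(-\frac qx\right)},$$ where at the points $x$ with $e_q(-q/x)=0$ (removable singularities of the right-hand side) the right-hand side is understood as its limit. -/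

import Mathlib

open Filter Topology

noncomputable section

namespace QEuler

/-! Throughout `q > 1` is real and `p = q⁻¹ ∈ (0,1)`. -/

/-- The theta function `θ_p(z) = ∑_{n ∈ ℤ} p^{n(n-1)/2} zⁿ` (for `0 < p < 1` and `z ≠ 0`);
the exponent `n(n-1)/2` is an exact integer division. -/
def theta (p : ℝ) (z : ℂ) : ℂ :=
  ∑' n : ℤ, (p : ℂ) ^ (n * (n - 1) / 2) * z ^ n

/-- The `q`-exponential `e_q(z) = (-(1-p)z; p)_∞ = ∏_{k ≥ 0} (1 + (1-p) p^k z)`, `p = q⁻¹`,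
an entire function for `q > 1`. -/
def qExp (q : ℝ) (z : ℂ) : ℂ :=
  ∏' k : ℕ, (1 + (1 - (q : ℂ)⁻¹) * ((q : ℂ)⁻¹) ^ k * z)

/-- The series `∑_{n ≥ 0} f(pⁿ y) pⁿ` defining the Jackson integral from `0` to `y` converges. -/
def JacksonSummable (p : ℝ) (f : ℂ → ℂ) (y : ℂ) : Prop :=
  Summable fun n : ℕ => f ((p : ℂ) ^ n * y) * (p : ℂ) ^ n

/-- The Jackson integral `∫_0^y f(t) d_p t = (1-p) y ∑_{n ≥ 0} f(pⁿ y) pⁿ`. -/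
def jacksonIntegral (p : ℝ) (f : ℂ → ℂ) (y : ℂ) : ℂ :=
  (1 - (p : ℂ)) * y * ∑' n : ℕ, f ((p : ℂ) ^ n * y) * (p : ℂ) ^ n

/-- The Jackson integral of `f` along the spiral `α p^ℤ` converges to `I`: all integrals
`∫_0^y f(t) d_p t`, `y ∈ α p^ℤ`, converge, and they tend to `I` as `|y| → ∞` on the spiral
(for `0 < p < 1`, this means `y = p^k α` with `k → -∞`). -/
def HasSpiralIntegral (p : ℝ) (f : ℂ → ℂ) (α : ℂ) (I : ℂ) : Prop :=
  (∀ k : ℤ, JacksonSummable p f ((p : ℂ) ^ k * α)) ∧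
    Tendsto (fun k : ℤ => jacksonIntegral p f ((p : ℂ) ^ k * α)) atBot (𝓝 I)

/-- The value of the Jackson integral of `f` along the spiral `α p^ℤ`. -/
def spiralIntegral (p : ℝ) (f : ℂ → ℂ) (α : ℂ) : ℂ :=
  limUnder atBot (fun k : ℤ => jacksonIntegral p f ((p : ℂ) ^ k * α))

/-- The `q`-Borel transform `ψ(ξ) = ∑ (-1)ⁿ ξⁿ = 1/(1+ξ)` of the `q`-Euler series
`∑ (-1)ⁿ [n]_q! x^{n+1}` (continued to `ξ ≠ -1`). -/
def psi (ξ : ℂ) : ℂ := 1 / (1 + ξ)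

/-- The integrand `ψ(ξ/(1-p)) / e_q(q ξ / ((1-p) x))` of the discrete `q`-Laplace transform. -/
def integrand (q : ℝ) (x : ℂ) (ξ : ℂ) : ℂ :=
  psi (ξ / (1 - (q : ℂ)⁻¹)) / qExp q (q * (ξ / ((1 - (q : ℂ)⁻¹) * x)))

/-- The discrete `q`-Borel sum of the `q`-Euler series along `[lam] = lam q^ℤ`:
`𝓔_q^{[lam]}(x) = q/(1-p) ∫_{lam p^ℤ} ψ(ξ/(1-p)) / e_q(q ξ / ((1-p) x)) d_p ξ`. -/
def discreteSum (q : ℝ) (lam x : ℂ) : ℂ :=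
  q / (1 - (q : ℂ)⁻¹) * spiralIntegral q⁻¹ (integrand q x) lam

/-- The Jackson integral defining `𝓔_q^{[lam]}(x)` converges. -/
def DiscreteSumConverges (q : ℝ) (lam x : ℂ) : Prop :=
  ∃ I : ℂ, HasSpiralIntegral q⁻¹ (integrand q x) lam I

/-- The theta quotient
`θ_p(-a/b) θ_p(-(1-p)/x) θ_p(-(1-p)ab/x) / (θ_p(a) θ_p(pb) θ_p((1-p)a/x) θ_p((1-p)b/x))`,
`p = q⁻¹`. -/
def thetaQuotient (q : ℝ) (a b x : ℂ) : ℂ :=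
  (theta q⁻¹ (-(a / b)) * theta q⁻¹ (-((1 - (q : ℂ)⁻¹) / x)) *
      theta q⁻¹ (-((1 - (q : ℂ)⁻¹) * a * b / x))) /
    (theta q⁻¹ a * theta q⁻¹ ((q : ℂ)⁻¹ * b) *
      theta q⁻¹ ((1 - (q : ℂ)⁻¹) * a / x) * theta q⁻¹ ((1 - (q : ℂ)⁻¹) * b / x))

end QEuler

end

/-!
A Jackson integral along a spiral is a bilateral series, so the discrete sum along `[λ]` is a
multiple of `S(a, w) = ∑_{n ∈ ℤ} pⁿ a / ((1 + pⁿ a) (-pⁿ w; p)_∞)` with `a = λ / (1 - p)`,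
`w = t a` and `t = q (1 - p) / x`. Let `θ(z) = (-z; p)_∞ (-p/z; p)_∞`. The function
`z ↦ θ(z) θ(t z) S(z, t z)` is holomorphic on `ℂ ∖ {0}`, because each pole of a term is cancelled
by a zero of a theta factor, and it satisfies `f(z) = t z² f(p z)`. Comparing Laurent coefficients,
the solutions of this equation form a space of dimension at most two, so `f` is determined by its
values at two nodes. At `z = b` it involves `S(b, t b)`, and at `z = -1` only the term with the
cancelled pole survives; the functions `θ(z) θ(t z)` and `θ(-z/b) θ(-t z b)` are the interpolation
basis for these nodes, which gives the connection formula. The same argument in degree one shows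
that `θ` is proportional to the theta series, as in the Jacobi triple product.
-/

noncomputable section

namespace QEuler

open scoped Real

section LaurentCoefficients

/-- The `n`-th Laurent coefficient of `f` on the circle `|z| = r`, as a mean value; on a function
holomorphic on `ℂ ∖ {0}` it does not depend on `r > 0`. -/
def laurentCoeff (f : ℂ → ℂ) (r : ℝ) (n : ℤ) : ℂ :=
  Real.circleAverage (fun z => z ^ (-n) * f z) 0 r

lemma circleAverage_norm_mul {E : Type*} [NormedAddCommGroup E] [NormedSpace ℝ E] (f : ℂ → E)
    (p : ℂ) (r : ℝ) :
    Real.circleAverage f 0 (‖p‖ * r) = Real.circleAverage (fun z => f (p * z)) 0 r := by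
  rw [Real.circleAverage_eq_integral_add p.arg, Real.circleAverage_def]
  have hp : circleMap 0 ‖p‖ p.arg = p := by
    rw [circleMap_zero, Complex.norm_mul_exp_arg_mul_I]
  simp only [add_comm _ p.arg, ← circleMap_zero_mul, hp]

variable {f : ℂ → ℂ}

lemma differentiableOn_zpow_mul (hf : DifferentiableOn ℂ f {0}ᶜ) (n : ℤ) :
    DifferentiableOn ℂ (fun z => z ^ n * f z) {0}ᶜ :=
  (differentiableOn_zpow n _ (Or.inl (by simp))).mul hf

lemma circleIntegrable_of_continuousOn_compl_zero (hf : ContinuousOn f {0}ᶜ) {r : ℝ}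
    (hr : 0 < r) : CircleIntegrable f 0 r :=
  (hf.mono fun _ hz => ne_zero_of_mem_sphere hr.ne' ⟨_, hz⟩).circleIntegrable hr.le

lemma laurentCoeff_eq_of_le (hf : DifferentiableOn ℂ f {0}ᶜ) {r R : ℝ} (hr : 0 < r)
    (h : r ≤ R) (n : ℤ) : laurentCoeff f R n = laurentCoeff f r n := by
  have hd : DifferentiableOn ℂ (fun z => (z - 0)⁻¹ • (z ^ (-n) * f z)) {0}ᶜ := by
    simpa only [zpow_neg_one, sub_zero, smul_eq_mul] using
      differentiableOn_zpow_mul (differentiableOn_zpow_mul hf (-n)) (-1)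
  have hne : ∀ z ∉ Metric.ball (0 : ℂ) r, z ∈ ({0}ᶜ : Set ℂ) := by
    rintro z hz rfl
    exact hz (Metric.mem_ball_self hr)
  rw [laurentCoeff, laurentCoeff, Real.circleAverage_eq_circleIntegral (hr.trans_le h).ne',
    Real.circleAverage_eq_circleIntegral hr.ne',
    Complex.circleIntegral_eq_of_differentiable_on_annulus_off_countable hr h
      Set.countable_empty (hd.continuousOn.mono fun z hz => hne z hz.2) fun z hz =>
        hd.differentiableAt (isOpen_compl_singleton.mem_nhds
          (hne z fun hz' => hz.1.2 (Metric.ball_subset_closedBall hz')))]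

lemma laurentCoeff_eq (hf : DifferentiableOn ℂ f {0}ᶜ) {r R : ℝ} (hr : 0 < r) (hR : 0 < R)
    (n : ℤ) : laurentCoeff f R n = laurentCoeff f r n := by
  rcases le_total r R with h | h
  · exact laurentCoeff_eq_of_le hf hr h n
  · exact (laurentCoeff_eq_of_le hf hR h n).symm

lemma laurentCoeff_sum {ι : Type*} {s : Finset ι} {F : ι → ℂ → ℂ} (c : ι → ℂ)
    (hF : ∀ i ∈ s, ContinuousOn (F i) {0}ᶜ) {r : ℝ} (hr : 0 < r) (n : ℤ) :
    laurentCoeff (fun z => ∑ i ∈ s, c i * F i z) r n = ∑ i ∈ s, c i * laurentCoeff (F i) r n := by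
  have hint : ∀ i ∈ s, CircleIntegrable (fun z => c i • (z ^ (-n) * F i z)) 0 r := fun i hi =>
    circleIntegrable_of_continuousOn_compl_zero (ContinuousOn.fun_const_smul
      ((continuousOn_zpow₀ (-n)).fun_mul (hF i hi)) (c i)) hr
  simp only [laurentCoeff, ← smul_eq_mul (c _), ← Real.circleAverage_fun_smul]
  rw [← Real.circleAverage_fun_sum hint]
  simp only [Finset.mul_sum, smul_eq_mul, mul_left_comm]

lemma fourierCoeff_comp_toCircle [Fact (0 < 2 * π)] (f : ℂ → ℂ) {r : ℝ} (hr : r ≠ 0) (n : ℤ) :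
    fourierCoeff (fun θ : AddCircle (2 * π) => f (r * θ.toCircle)) n =
      r ^ n * laurentCoeff f r n := by
  have hcircle (θ : ℝ) :
      (r : ℂ) * AddCircle.toCircle (θ : AddCircle (2 * π)) = circleMap 0 r θ := by
    simp [circleMap_zero, AddCircle.toCircle_apply_mk, Real.pi_ne_zero]
  have hfourier (θ : ℝ) :
      fourier (-n) (θ : AddCircle (2 * π)) = (r : ℂ) ^ n * circleMap 0 r θ ^ (-n) := by
    rw [fourier_apply, AddCircle.toCircle_zsmul, Circle.coe_zpow, ← hcircle, mul_zpow,
      ← mul_assoc, ← zpow_add₀ (by exact_mod_cast hr), add_neg_cancel, zpow_zero, one_mul]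
  rw [fourierCoeff_eq_intervalIntegral _ n 0, laurentCoeff, ← smul_eq_mul (_ ^ n),
    ← Real.circleAverage_fun_smul, Real.circleAverage_def]
  simp only [hcircle, hfourier, zero_add, one_div, smul_eq_mul, mul_assoc]

lemma eq_zero_of_laurentCoeff_eq_zero_of_mem_sphere {r : ℝ}
    (hf : ContinuousOn f (Metric.sphere 0 r)) (h : ∀ n, laurentCoeff f r n = 0) {z : ℂ}
    (hz : z ∈ Metric.sphere 0 r) (hz0 : z ≠ 0) : f z = 0 := by
  obtain rfl : ‖z‖ = r := mem_sphere_zero_iff_norm.mp hz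
  have : Fact (0 < 2 * π) := ⟨Real.two_pi_pos⟩
  have hcont : Continuous fun θ : AddCircle (2 * π) => f (‖z‖ * θ.toCircle) :=
    hf.comp_continuous (continuous_const.mul
      (continuous_subtype_val.comp AddCircle.continuous_toCircle)) (by simp [Circle.norm_coe])
  let F : C(AddCircle (2 * π), ℂ) := ⟨_, hcont⟩
  have hcoeff : fourierCoeff F = 0 := by
    ext n
    exact (fourierCoeff_comp_toCircle f (norm_ne_zero_iff.mpr hz0) n).trans (by simp [h n])
  have hsum := has_pointwise_sum_fourier_series_of_summable (f := F)
    (hcoeff ▸ summable_zero) (z.arg : AddCircle (2 * π))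
  simp only [hcoeff, Pi.zero_apply, zero_smul] at hsum
  simpa [F, AddCircle.toCircle_apply_mk, Real.pi_ne_zero] using hsum.unique hasSum_zero

lemma eq_zero_of_laurentCoeff_eq_zero (hf : DifferentiableOn ℂ f {0}ᶜ) {r : ℝ} (hr : 0 < r)
    (h : ∀ n, laurentCoeff f r n = 0) {z : ℂ} (hz : z ≠ 0) : f z = 0 := by
  have hz' : 0 < ‖z‖ := norm_pos_iff.mpr hz
  refine eq_zero_of_laurentCoeff_eq_zero_of_mem_sphere
    (hf.continuousOn.mono fun w hw => ne_zero_of_mem_sphere hz'.ne' ⟨w, hw⟩)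
    (fun n => (laurentCoeff_eq hf hr hz' n).trans (h n)) (by simp) hz

end LaurentCoefficients

section QuasiPeriodic

/-- Quasi-periodicity of degree `k` and multiplier `t` with respect to `z ↦ p z`: `f` is
holomorphic on `ℂ ∖ {0}` and `f(z) = t zᵏ f(p z)` there. -/
structure IsQuasiPeriodic (p t : ℂ) (k : ℕ) (f : ℂ → ℂ) : Prop where
  differentiableOn : DifferentiableOn ℂ f {0}ᶜ
  apply_eq : ∀ z, z ≠ 0 → f z = t * z ^ k * f (p * z)

variable {p t : ℂ} {k : ℕ} {ι : Type*} [Fintype ι]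

lemma IsQuasiPeriodic.sum {F : ι → ℂ → ℂ} (c : ι → ℂ) (hF : ∀ i, IsQuasiPeriodic p t k (F i)) :
    IsQuasiPeriodic p t k fun z => ∑ i, c i * F i z where
  differentiableOn := .fun_sum fun i _ => (hF i).differentiableOn.const_mul _
  apply_eq z hz := by
    rw [Finset.mul_sum]
    exact Finset.sum_congr rfl fun i _ => by rw [(hF i).apply_eq z hz]; ring

lemma IsQuasiPeriodic.laurentCoeff_add {f : ℂ → ℂ} (hf : IsQuasiPeriodic p t k f) (hp : p ≠ 0)
    (n : ℤ) : laurentCoeff f 1 (n + k) = t * p ^ n * laurentCoeff f 1 n := by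
  rw [laurentCoeff_eq hf.differentiableOn (norm_pos_iff.mpr hp) one_pos n, ← mul_one ‖p‖,
    laurentCoeff, laurentCoeff, circleAverage_norm_mul, ← smul_eq_mul (t * p ^ n),
    ← Real.circleAverage_fun_smul]
  refine Real.circleAverage_congr_sphere fun z hz => ?_
  have hz0 : z ≠ 0 := ne_zero_of_mem_sphere (by simp) ⟨z, hz⟩
  have hcancel : p ^ n * p ^ (-n) = 1 := by rw [← zpow_add₀ hp, add_neg_cancel, zpow_zero]
  simp only [smul_eq_mul]
  rw [hf.apply_eq z hz0, mul_zpow, neg_add, zpow_add₀ hz0, zpow_neg z (k : ℤ), zpow_natCast]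
  field_simp
  linear_combination (-(t * f (p * z))) * hcancel

lemma IsQuasiPeriodic.eq_zero {f : ℂ → ℂ} (hf : IsQuasiPeriodic p t k f) (hp : p ≠ 0)
    (hk : 0 < k) (h : ∀ i : Fin k, laurentCoeff f 1 (i : ℕ) = 0) {z : ℂ} (hz : z ≠ 0) :
    f z = 0 := by
  rcases eq_or_ne t 0 with rfl | ht
  · rw [hf.apply_eq z hz, zero_mul, zero_mul]
  have hstep (n : ℤ) : laurentCoeff f 1 (n + k) = 0 ↔ laurentCoeff f 1 n = 0 := by
    simp [hf.laurentCoeff_add hp, ht, zpow_ne_zero n hp]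
  have hsteps (i j : ℤ) (hi : laurentCoeff f 1 i = 0) : laurentCoeff f 1 (i + k * j) = 0 := by
    induction j using Int.induction_on with
    | zero => simpa using hi
    | succ j ih => rwa [mul_add_one, ← add_assoc, hstep]
    | pred j ih => rwa [← hstep, add_assoc, ← mul_add_one, sub_add_cancel]
  refine eq_zero_of_laurentCoeff_eq_zero hf.differentiableOn one_pos (fun n => ?_) hz
  have hk' : (0 : ℤ) < k := by exact_mod_cast hk
  rw [← Int.emod_add_mul_ediv n k]
  refine hsteps _ _ ?_
  obtain ⟨i, hi⟩ := Int.eq_ofNat_of_zero_le (Int.emod_nonneg n hk'.ne')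
  have hik : i < k := by exact_mod_cast hi ▸ Int.emod_lt_of_pos n hk'
  simpa only [hi] using h ⟨i, hik⟩

lemma exists_relation_of_isQuasiPeriodic (hp : p ≠ 0) (hk : 0 < k)
    (hcard : k < Fintype.card ι) {F : ι → ℂ → ℂ} (hF : ∀ i, IsQuasiPeriodic p t k (F i)) :
    ∃ c : ι → ℂ, c ≠ 0 ∧ ∀ z, z ≠ 0 → ∑ i, c i * F i z = 0 := by
  have hdep : ¬LinearIndependent ℂ fun (i : ι) (j : Fin k) => laurentCoeff (F i) 1 (j : ℕ) :=
    fun h => hcard.not_ge (by simpa using h.fintype_card_le_finrank)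
  obtain ⟨c, hc, i, hi⟩ := Fintype.not_linearIndependent_iff.mp hdep
  refine ⟨c, fun h => hi (congrFun h i), fun z hz =>
    (IsQuasiPeriodic.sum c hF).eq_zero hp hk (fun j => ?_) hz⟩
  rw [laurentCoeff_sum c (fun i _ => (hF i).differentiableOn.continuousOn) one_pos]
  simpa using congrFun hc j

lemma IsQuasiPeriodic.eq_sum_interpolation [Nonempty ι] {f : ℂ → ℂ}
    {F : ι → ℂ → ℂ} {x : ι → ℂ} (hf : IsQuasiPeriodic p t (Fintype.card ι) f)
    (hF : ∀ i, IsQuasiPeriodic p t (Fintype.card ι) (F i)) (hp : p ≠ 0)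
    (hx : ∀ i, x i ≠ 0) (hFx : ∀ i j, F i (x j) = 0 ↔ i ≠ j) {z : ℂ} (hz : z ≠ 0) :
    f z = ∑ i, f (x i) / F i (x i) * F i z := by
  obtain ⟨c, hc, hrel⟩ := exists_relation_of_isQuasiPeriodic (F := fun o : Option ι => o.elim f F)
    hp Fintype.card_pos (by simp) (Option.rec hf hF)
  simp only [Fintype.sum_option, Option.elim] at hrel
  have hdiag (j : ι) : F j (x j) ≠ 0 := fun h => (hFx j j).mp h rfl
  have hcoeff (j : ι) : c (some j) = -c none * (f (x j) / F j (x j)) := by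
    have hnode := hrel (x j) (hx j)
    rw [Finset.sum_eq_single j (fun i _ hij => by rw [(hFx i j).mpr hij, mul_zero])
      (by simp)] at hnode
    field_simp [hdiag j]
    linear_combination hnode
  have hnone : c none ≠ 0 := fun h => hc <| by
    ext (_ | j)
    · exact h
    · simp [hcoeff, h]
  have hzero := hrel z hz
  simp only [hcoeff, mul_assoc, neg_mul, Finset.sum_neg_distrib, ← Finset.mul_sum] at hzero ⊢
  exact mul_left_cancel₀ hnone (by linear_combination hzero)

end QuasiPeriodic

lemma triangle_zpow_add_one {G₀ : Type*} [GroupWithZero G₀] {p : G₀} (hp0 : p ≠ 0) (n : ℤ) :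
    p ^ ((n + 1) * (n + 1 - 1) / 2) = p ^ (n * (n - 1) / 2) * p ^ n := by
  rw [← zpow_add₀ hp0, show (n + 1) * (n + 1 - 1) = n * (n - 1) + n * 2 by ring,
    Int.add_mul_ediv_right _ _ two_ne_zero]

section Products

variable {𝕜 : Type*} [NormedField 𝕜]

/-- The infinite product `(-z; p)_∞ = ∏_{k ≥ 0} (1 + pᵏ z)`. Taken over `ℂ` it is the object of
study; taken over `ℝ`, at `‖p‖` and `‖z‖`, it provides the bounds. -/
def qProd (p z : 𝕜) : 𝕜 := ∏' k : ℕ, (1 + p ^ k * z)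

/-- The product `(-z; p)_∞ (-p/z; p)_∞`, which the Jacobi triple product identifies with the
theta function up to a constant factor. -/
def thetaProd (p z : 𝕜) : 𝕜 := qProd p z * qProd p (p / z)

lemma qProd_zero (p : 𝕜) : qProd p 0 = 1 := by simp [qProd]

lemma thetaProd_mul_eq_inv {p : 𝕜} (hp : p ≠ 0) (z : 𝕜) :
    thetaProd p (p * z) = thetaProd p z⁻¹ := by
  rw [thetaProd, thetaProd, div_mul_cancel_left₀ hp, div_inv_eq_mul, mul_comm]

variable {p z : 𝕜}

lemma summable_norm_pow_mul (hp : ‖p‖ < 1) (z : 𝕜) : Summable fun k : ℕ => ‖p ^ k * z‖ := by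
  simp only [norm_mul, norm_pow]
  exact (summable_geometric_of_lt_one (norm_nonneg p) hp).mul_right _

variable [CompleteSpace 𝕜]

lemma multipliable_qProd (hp : ‖p‖ < 1) (z : 𝕜) : Multipliable fun k : ℕ => 1 + p ^ k * z :=
  multipliable_one_add_of_summable (summable_norm_pow_mul hp z)

lemma qProd_eq_mul (hp : ‖p‖ < 1) (z : 𝕜) : qProd p z = (1 + z) * qProd p (p * z) := by
  have hshift (k : ℕ) : 1 + p ^ (k + 1) * z = 1 + p ^ k * (p * z) := by ring
  rw [qProd, tprod_eq_zero_mul' (by simpa only [hshift] using multipliable_qProd hp (p * z))]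
  simp only [hshift, pow_zero, one_mul, qProd]

lemma qProd_ne_zero (hp : ‖p‖ < 1) (h : ∀ k : ℕ, 1 + p ^ k * z ≠ 0) : qProd p z ≠ 0 :=
  tprod_one_add_ne_zero_of_summable h (summable_norm_pow_mul hp z)

lemma continuous_qProd (hp : ‖p‖ < 1) : Continuous (qProd p) :=
  continuous_iff_continuousAt.mpr fun z =>
    tendsto_tprod_one_add_of_dominated_convergence
      ((summable_geometric_of_lt_one (norm_nonneg p) hp).mul_right (‖z‖ + 1))
      (fun k => (continuous_const_mul (p ^ k)).tendsto z)
      (by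
        filter_upwards [continuous_norm.continuousAt.eventually_lt continuousAt_const
          (lt_add_one ‖z‖)] with w hw k
        rw [norm_mul, norm_pow]
        gcongr)

lemma norm_qProd_le (hp : ‖p‖ < 1) (z : 𝕜) : ‖qProd p z‖ ≤ qProd ‖p‖ ‖z‖ := by
  have hp' : ‖‖p‖‖ < 1 := by rwa [norm_norm]
  refine le_of_tendsto_of_tendsto' (multipliable_qProd hp z).hasProd.norm
    (multipliable_qProd hp' ‖z‖).hasProd fun s => ?_
  refine Finset.prod_le_prod (fun _ _ => norm_nonneg _) fun k _ => ?_
  simpa only [norm_one, norm_mul, norm_pow] using norm_add_le 1 (p ^ k * z)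

lemma one_add_le_qProd {ρ r : ℝ} (hρ0 : 0 ≤ ρ) (hρ1 : ρ < 1) (hr : 0 ≤ r) :
    1 + r ≤ qProd ρ r := by
  have hρ : ‖ρ‖ < 1 := by rwa [Real.norm_of_nonneg hρ0]
  have hone : 1 ≤ qProd ρ (ρ * r) :=
    ge_of_tendsto' (multipliable_qProd hρ _).hasProd fun s =>
      Finset.one_le_prod fun k _ => le_add_of_nonneg_right (by positivity)
  rw [qProd_eq_mul hρ]
  exact le_mul_of_one_le_right (by positivity) hone

lemma thetaProd_eq_mul (hp : ‖p‖ < 1) (hp0 : p ≠ 0) (hz : z ≠ 0) :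
    thetaProd p z = z * thetaProd p (p * z) := by
  have hdiv : p / (p * z) = z⁻¹ := div_mul_cancel_left₀ hp0 z
  rw [thetaProd, thetaProd, qProd_eq_mul hp z, hdiv, qProd_eq_mul hp z⁻¹, div_eq_mul_inv]
  field_simp
  ring

lemma thetaProd_neg_one (hp : ‖p‖ < 1) : thetaProd p (-1) = 0 := by
  rw [thetaProd, qProd_eq_mul hp, add_neg_cancel, zero_mul, zero_mul]

lemma thetaProd_ne_zero (hp : ‖p‖ < 1) (hp0 : p ≠ 0) (hz : z ≠ 0)
    (h : ∀ n : ℤ, 1 + p ^ n * z ≠ 0) : thetaProd p z ≠ 0 := by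
  refine mul_ne_zero (qProd_ne_zero hp fun k => by simpa using h k)
    (qProd_ne_zero hp fun k hk => h (-(k + 1 : ℕ)) ?_)
  rw [zpow_neg, zpow_natCast]
  field_simp at hk ⊢
  linear_combination hk

lemma thetaProd_eq_zpow_mul (hp : ‖p‖ < 1) (hp0 : p ≠ 0) (hz : z ≠ 0) (n : ℤ) :
    thetaProd p z = p ^ (n * (n - 1) / 2) * z ^ n * thetaProd p (p ^ n * z) := by
  have hstep (n : ℤ) : p ^ (n * (n - 1) / 2) * z ^ n * thetaProd p (p ^ n * z) =
      p ^ ((n + 1) * (n + 1 - 1) / 2) * z ^ (n + 1) * thetaProd p (p ^ (n + 1) * z) := by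
    rw [triangle_zpow_add_one hp0, zpow_add_one₀ hz, zpow_add_one₀ hp0, mul_comm (p ^ n) p,
      mul_assoc p, thetaProd_eq_mul hp hp0 (mul_ne_zero (zpow_ne_zero n hp0) hz)]
    ring
  induction n using Int.induction_on with
  | zero => simp
  | succ j ih => rw [ih, hstep]
  | pred j ih => rw [ih, hstep (-j - 1), sub_add_cancel]

lemma continuousOn_thetaProd (hp : ‖p‖ < 1) : ContinuousOn (thetaProd p) {0}ᶜ :=
  (continuous_qProd hp).continuousOn.mul
    ((continuous_qProd hp).comp_continuousOn (continuousOn_const.div continuousOn_id fun _ => id))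

end Products

section ComplexProducts

variable {p : ℂ}

lemma differentiable_qProd (hp : ‖p‖ < 1) : Differentiable ℂ (qProd p) := by
  intro z
  have hlim := Summable.hasProdLocallyUniformlyOn_nat_one_add (K := Metric.ball 0 (‖z‖ + 1))
    (f := fun (k : ℕ) (w : ℂ) => p ^ k * w) Metric.isOpen_ball
    ((summable_geometric_of_lt_one (norm_nonneg p) hp).mul_right (‖z‖ + 1))
    (.of_forall fun k w hw => by
      rw [norm_mul, norm_pow]
      gcongr
      exact (mem_ball_zero_iff.mp hw).le)
    (fun k => by fun_prop)
  have hd : DifferentiableOn ℂ (qProd p) (Metric.ball 0 (‖z‖ + 1)) :=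
    hlim.differentiableOn (.of_forall fun _ => by
      simpa [Finset.prod_fn] using DifferentiableOn.finsetProd fun _ _ => by fun_prop)
      Metric.isOpen_ball
  exact hd.differentiableAt (Metric.isOpen_ball.mem_nhds (by simp))

lemma differentiableOn_thetaProd (hp : ‖p‖ < 1) : DifferentiableOn ℂ (thetaProd p) {0}ᶜ :=
  (differentiable_qProd hp).differentiableOn.mul
    ((differentiable_qProd hp).comp_differentiableOn
      ((differentiableOn_const p).div differentiableOn_id fun _ => id))

lemma isQuasiPeriodic_thetaProd (hp : ‖p‖ < 1) (hp0 : p ≠ 0) :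
    IsQuasiPeriodic p 1 1 (thetaProd p) where
  differentiableOn := differentiableOn_thetaProd hp
  apply_eq z hz := by rw [pow_one, one_mul, ← thetaProd_eq_mul hp hp0 hz]

end ComplexProducts

section ThetaQuotients

variable {𝕜 : Type*} [NormedField 𝕜]

/-- The quotient `θ(w) / (-pⁿ w; p)_∞` of `θ = thetaProd p` by a tail of one of its two products,
in a form without poles. -/
def thetaDivQProd (p : 𝕜) (n : ℤ) (w : 𝕜) : 𝕜 :=
  p ^ (n * (n - 1) / 2) * w ^ n * qProd p (p / (p ^ n * w))

/-- The quotient `θ(a) / (1 + pⁿ a)` of `θ = thetaProd p` by one of its factors, in a form without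
poles. -/
def thetaDivOneAdd (p : 𝕜) (n : ℤ) (a : 𝕜) : 𝕜 :=
  thetaDivQProd p n a * qProd p (p * (p ^ n * a))

lemma thetaDivQProd_add_one {p w : 𝕜} (hp0 : p ≠ 0) (hw : w ≠ 0) (n : ℤ) :
    thetaDivQProd p (n + 1) w = w * thetaDivQProd p n (p * w) := by
  rw [thetaDivQProd, thetaDivQProd, triangle_zpow_add_one hp0, mul_zpow, zpow_add_one₀ hw,
    zpow_add_one₀ hp0, mul_assoc (p ^ n) p w]
  ring

lemma thetaDivOneAdd_add_one {p a : 𝕜} (hp0 : p ≠ 0) (ha : a ≠ 0) (n : ℤ) :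
    thetaDivOneAdd p (n + 1) a = a * thetaDivOneAdd p n (p * a) := by
  rw [thetaDivOneAdd, thetaDivOneAdd, thetaDivQProd_add_one hp0 ha, zpow_add_one₀ hp0,
    mul_assoc (p ^ n) p a, mul_assoc]

variable [CompleteSpace 𝕜] {p z : 𝕜}

lemma thetaDivQProd_mul_qProd (hp : ‖p‖ < 1) (hp0 : p ≠ 0) (hz : z ≠ 0) (n : ℤ) :
    thetaDivQProd p n z * qProd p (p ^ n * z) = thetaProd p z := by
  rw [thetaProd_eq_zpow_mul hp hp0 hz n, thetaDivQProd, thetaProd]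
  ring

lemma thetaDivOneAdd_mul_one_add (hp : ‖p‖ < 1) (hp0 : p ≠ 0) (hz : z ≠ 0) (n : ℤ) :
    thetaDivOneAdd p n z * (1 + p ^ n * z) = thetaProd p z := by
  rw [← thetaDivQProd_mul_qProd hp hp0 hz n, thetaDivOneAdd, qProd_eq_mul hp (p ^ n * z)]
  ring

lemma norm_thetaDivQProd_le (hp : ‖p‖ < 1) (n : ℤ) (z : 𝕜) :
    ‖thetaDivQProd p n z‖ ≤ thetaDivQProd ‖p‖ n ‖z‖ := by
  rw [thetaDivQProd, thetaDivQProd, norm_mul, norm_mul, norm_zpow, norm_zpow]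
  gcongr
  simpa only [norm_div, norm_mul, norm_zpow] using norm_qProd_le hp (p / (p ^ n * z))

lemma norm_thetaDivOneAdd_le (hp : ‖p‖ < 1) (n : ℤ) (z : 𝕜) :
    ‖thetaDivOneAdd p n z‖ ≤ thetaDivOneAdd ‖p‖ n ‖z‖ := by
  have hle := norm_thetaDivQProd_le hp n z
  rw [thetaDivOneAdd, thetaDivOneAdd, norm_mul]
  refine mul_le_mul hle ?_ (norm_nonneg _) ((norm_nonneg _).trans hle)
  simpa only [norm_mul, norm_zpow] using norm_qProd_le hp (p * (p ^ n * z))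

lemma norm_thetaDivQProd_mul_le (hp : ‖p‖ < 1) (hp0 : p ≠ 0) (hz : z ≠ 0) (n : ℤ) :
    ‖thetaDivQProd p n z‖ * (1 + ‖p‖ ^ n * ‖z‖) ≤ thetaProd ‖p‖ ‖z‖ := by
  rw [← thetaDivQProd_mul_qProd (by rwa [norm_norm]) (norm_ne_zero_iff.mpr hp0)
    (norm_ne_zero_iff.mpr hz) n]
  have hle := norm_thetaDivQProd_le hp n z
  exact mul_le_mul hle (one_add_le_qProd (norm_nonneg p) hp (by positivity)) (by positivity)
    ((norm_nonneg _).trans hle)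

lemma norm_thetaDivOneAdd_mul_le (hp : ‖p‖ < 1) (hp0 : p ≠ 0) (hz : z ≠ 0) (n : ℤ) :
    ‖thetaDivOneAdd p n z‖ * (1 + ‖p‖ ^ n * ‖z‖) ≤ thetaProd ‖p‖ ‖z‖ := by
  rw [← thetaDivOneAdd_mul_one_add (by rwa [norm_norm]) (norm_ne_zero_iff.mpr hp0)
    (norm_ne_zero_iff.mpr hz) n]
  gcongr
  exact norm_thetaDivOneAdd_le hp n z

end ThetaQuotients

section ComplexThetaQuotients

variable {p : ℂ}

lemma differentiableOn_thetaDivQProd (hp : ‖p‖ < 1) (hp0 : p ≠ 0) (n : ℤ) :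
    DifferentiableOn ℂ (thetaDivQProd p n) {0}ᶜ :=
  ((differentiableOn_zpow n _ (.inl (by simp))).const_mul _).mul
    ((differentiable_qProd hp).comp_differentiableOn
      ((differentiableOn_const p).div (differentiableOn_id.const_mul _) fun _ hz =>
        mul_ne_zero (zpow_ne_zero n hp0) hz))

lemma differentiableOn_thetaDivOneAdd (hp : ‖p‖ < 1) (hp0 : p ≠ 0) (n : ℤ) :
    DifferentiableOn ℂ (thetaDivOneAdd p n) {0}ᶜ :=
  (differentiableOn_thetaDivQProd hp hp0 n).mul
    ((differentiable_qProd hp).comp_differentiableOn (by fun_prop))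

end ComplexThetaQuotients

section DominatedSeries

lemma summable_pow_natAbs {ρ : ℝ} (hρ0 : 0 ≤ ρ) (hρ1 : ρ < 1) :
    Summable fun n : ℤ => ρ ^ n.natAbs := by
  have h := summable_geometric_of_lt_one hρ0 hρ1
  exact .of_nat_of_neg (by simpa using h) (by simpa using h)

lemma le_add_mul_pow_natAbs {ρ A B x : ℝ} {n : ℤ} (hρ : 0 ≤ ρ) (hA : 0 ≤ A) (hB : 0 ≤ B)
    (h : x ≤ A * ρ ^ n) (h' : x ≤ B * ρ ^ (-n)) : x ≤ (A + B) * ρ ^ n.natAbs := by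
  have hpow : 0 ≤ ρ ^ n.natAbs := by positivity
  rw [add_mul]
  rcases n.natAbs_eq with hn | hn
  · rw [hn, zpow_natCast] at h
    exact h.trans (le_add_of_nonneg_right (mul_nonneg hB hpow))
  · rw [hn, neg_neg, zpow_natCast] at h'
    exact h'.trans (le_add_of_nonneg_left (mul_nonneg hA hpow))

lemma differentiableOn_tsum_of_norm_le_mul {ι : Type*} {U : Set ℂ} {F : ι → ℂ → ℂ} {M : ℂ → ℝ}
    {u : ι → ℝ} (hU : IsOpen U) (hF : ∀ i, DifferentiableOn ℂ (F i) U) (hM : ContinuousOn M U)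
    (hu : Summable u) (hu0 : ∀ i, 0 ≤ u i) (hle : ∀ i, ∀ z ∈ U, ‖F i z‖ ≤ M z * u i) :
    DifferentiableOn ℂ (fun z => ∑' i, F i z) U := by
  intro z hz
  have hV := hM.isOpen_inter_preimage hU (isOpen_Iio (a := M z + 1))
  have hd := Complex.differentiableOn_tsum_of_summable_norm (hu.mul_left (M z + 1))
    (fun i => (hF i).mono Set.inter_subset_left) hV
    (fun i w hw => (hle i w hw.1).trans (mul_le_mul_of_nonneg_right (le_of_lt hw.2) (hu0 i)))
  exact (hd.differentiableAt (hV.mem_nhds ⟨hz, lt_add_one (M z)⟩)).differentiableWithinAt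

end DominatedSeries

section Theta

lemma zpow_mul_zpow_mul_le_thetaProd {ρ r : ℝ} (hρ0 : 0 < ρ) (hρ1 : ρ < 1) (hr : 0 < r) (n : ℤ) :
    ρ ^ (n * (n - 1) / 2) * r ^ n * ((1 + ρ ^ n * r) * (1 + ρ / (ρ ^ n * r))) ≤
      thetaProd ρ r := by
  have hρ : ‖ρ‖ < 1 := by rwa [Real.norm_of_nonneg hρ0.le]
  rw [thetaProd_eq_zpow_mul hρ hρ0.ne' hr.ne' n, thetaProd]
  have hle {s : ℝ} (hs : 0 ≤ s) := one_add_le_qProd hρ0.le hρ1 hs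
  gcongr
  · exact le_trans (by positivity) (hle (s := ρ ^ n * r) (by positivity))
  · exact hle (by positivity)
  · exact hle (by positivity)

lemma zpow_mul_zpow_le_pow_natAbs {ρ r : ℝ} (hρ0 : 0 < ρ) (hρ1 : ρ < 1) (hr : 0 < r) (n : ℤ) :
    ρ ^ (n * (n - 1) / 2) * r ^ n ≤ thetaProd ρ r * (r / ρ + r⁻¹) * ρ ^ n.natAbs := by
  have hle := zpow_mul_zpow_mul_le_thetaProd hρ0 hρ1 hr n
  set x := ρ ^ (n * (n - 1) / 2) * r ^ n
  have hx : 0 < x := by positivity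
  have hy : 0 < ρ ^ n * r := by positivity
  set y := ρ ^ n * r with hy_def
  have hΘ : 0 ≤ thetaProd ρ r := le_trans (by positivity) hle
  rw [mul_add]
  refine le_add_mul_pow_natAbs hρ0.le (by positivity) (by positivity) ?_ ?_
  · calc x = x * (ρ / y) * (y / ρ) := by field_simp
      _ ≤ x * ((1 + y) * (1 + ρ / y)) * (y / ρ) := by
        gcongr
        nlinarith [div_pos hρ0 hy]
      _ ≤ thetaProd ρ r * (y / ρ) := by gcongr
      _ = thetaProd ρ r * (r / ρ) * ρ ^ n := by rw [hy_def]; ring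
  · calc x = x * y * y⁻¹ := by field_simp
      _ ≤ x * ((1 + y) * (1 + ρ / y)) * y⁻¹ := by
        gcongr
        nlinarith [div_pos hρ0 hy]
      _ ≤ thetaProd ρ r * y⁻¹ := by gcongr
      _ = thetaProd ρ r * r⁻¹ * ρ ^ (-n) := by rw [hy_def, mul_inv, zpow_neg]; ring

variable {p : ℝ}

lemma isQuasiPeriodic_theta (hp0 : 0 < p) (hp1 : p < 1) : IsQuasiPeriodic p 1 1 (theta p) where
  differentiableOn := by
    have hp : ‖p‖ < 1 := by rwa [Real.norm_of_nonneg hp0.le]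
    have hnorm : ContinuousOn (fun z : ℂ => ‖z‖) {0}ᶜ := continuous_norm.continuousOn
    refine differentiableOn_tsum_of_norm_le_mul
      (M := fun z => thetaProd p ‖z‖ * (‖z‖ / p + ‖z‖⁻¹)) isOpen_compl_singleton
      (fun n => (differentiableOn_zpow n _ (.inl (by simp))).const_mul _) ?_
      (summable_pow_natAbs hp0.le hp1) (fun n => by positivity) (fun n z hz => ?_)
    · exact ((continuousOn_thetaProd hp).comp hnorm fun z hz => norm_ne_zero_iff.mpr hz).mul
        ((hnorm.div_const p).add (hnorm.inv₀ fun z hz => norm_ne_zero_iff.mpr hz))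
    · rw [norm_mul, norm_zpow, norm_zpow, Complex.norm_real, Real.norm_of_nonneg hp0.le]
      exact zpow_mul_zpow_le_pow_natAbs hp0 hp1 (norm_pos_iff.mpr hz) n
  apply_eq z hz := by
    have hp : (p : ℂ) ≠ 0 := Complex.ofReal_ne_zero.mpr hp0.ne'
    rw [theta, theta, ← tsum_mul_left, ← (Equiv.addRight (1 : ℤ)).tsum_eq]
    refine tsum_congr fun n => ?_
    rw [Equiv.coe_addRight, triangle_zpow_add_one hp, zpow_add_one₀ hz, mul_zpow]
    ring

lemma theta_eq_mul_thetaProd (hp0 : 0 < p) (hp1 : p < 1) {z : ℂ} (hz : z ≠ 0) :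
    theta p z = theta p 1 / thetaProd (p : ℂ) 1 * thetaProd (p : ℂ) z := by
  have hpC0 : (p : ℂ) ≠ 0 := Complex.ofReal_ne_zero.mpr hp0.ne'
  have hpC : ‖(p : ℂ)‖ < 1 := by rwa [Complex.norm_real, Real.norm_of_nonneg hp0.le]
  have hone : thetaProd (p : ℂ) 1 ≠ 0 := by
    refine thetaProd_ne_zero hpC hpC0 one_ne_zero fun n => ?_
    rw [mul_one]
    exact_mod_cast (by positivity : (1 + p ^ n : ℝ) ≠ 0)
  simpa using (isQuasiPeriodic_theta hp0 hp1).eq_sum_interpolation (ι := Unit)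
    (F := fun _ => thetaProd (p : ℂ)) (x := fun _ => 1)
    (fun _ => isQuasiPeriodic_thetaProd hpC hpC0) hpC0 (fun _ => one_ne_zero)
    (fun _ _ => by simpa using hone) hz

lemma theta_one_ne_zero (hp0 : 0 < p) (hp1 : p < 1) : theta p 1 ≠ 0 := by
  have hsum : Summable fun n : ℤ => p ^ (n * (n - 1) / 2) :=
    .of_nonneg_of_le (fun n => by positivity)
      (fun n => by simpa using zpow_mul_zpow_le_pow_natAbs hp0 hp1 one_pos n)
      ((summable_pow_natAbs hp0.le hp1).mul_left _)
  have hcast : theta p 1 = (∑' n : ℤ, p ^ (n * (n - 1) / 2) : ℝ) := by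
    simp [theta, Complex.ofReal_tsum]
  rw [hcast, Complex.ofReal_ne_zero]
  exact (hsum.tsum_pos (fun n => by positivity) 0 (by positivity)).ne'

end Theta

section BilateralSum

/-- The sum `∑_{n ∈ ℤ} pⁿ a / ((1 + pⁿ a) (-pⁿ w; p)_∞)`, to which the Jackson integrals of the
discrete `q`-Borel sum reduce. -/
def bilateralSum (p a w : ℂ) : ℂ :=
  ∑' n : ℤ, p ^ n * a / ((1 + p ^ n * a) * qProd p (p ^ n * w))

/-- The terms of `bilateralSum p a w` multiplied by `thetaProd p a * thetaProd p w`, in a form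
without poles. -/
def regularTerm (p a w : ℂ) (n : ℤ) : ℂ :=
  p ^ n * a * thetaDivOneAdd p n a * thetaDivQProd p n w

/-- The product `thetaProd p a * thetaProd p w * bilateralSum p a w`, in a form holomorphic in
`a, w ≠ 0`. -/
def regularSum (p a w : ℂ) : ℂ := ∑' n : ℤ, regularTerm p a w n

variable {p a w : ℂ}

lemma norm_regularTerm_le (hp : ‖p‖ < 1) (hp0 : p ≠ 0) (ha : a ≠ 0) (hw : w ≠ 0) (n : ℤ) :
    ‖regularTerm p a w n‖ ≤
      thetaProd ‖p‖ ‖a‖ * thetaProd ‖p‖ ‖w‖ * (‖a‖ + ‖w‖⁻¹) * ‖p‖ ^ n.natAbs := by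
  have hA := norm_thetaDivOneAdd_mul_le hp hp0 ha n
  have hW := norm_thetaDivQProd_mul_le hp hp0 hw n
  have hra : 0 < ‖p‖ ^ n * ‖a‖ := by positivity
  have hrw : 0 < ‖p‖ ^ n * ‖w‖ := by positivity
  have hΘa : 0 ≤ thetaProd ‖p‖ ‖a‖ := le_trans (by positivity) hA
  have hΘw : 0 ≤ thetaProd ‖p‖ ‖w‖ := le_trans (by positivity) hW
  rw [mul_one_add] at hA hW
  have hA0 := norm_nonneg (thetaDivOneAdd p n a)
  have hW0 := norm_nonneg (thetaDivQProd p n w)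
  rw [regularTerm, norm_mul, norm_mul, norm_mul, norm_zpow, mul_add]
  set A := ‖thetaDivOneAdd p n a‖
  set W := ‖thetaDivQProd p n w‖
  refine le_add_mul_pow_natAbs (norm_nonneg p) (by positivity) (by positivity) ?_ ?_
  · calc ‖p‖ ^ n * ‖a‖ * A * W
        ≤ ‖p‖ ^ n * ‖a‖ * thetaProd ‖p‖ ‖a‖ * thetaProd ‖p‖ ‖w‖ := by
          gcongr
          · exact (le_add_of_nonneg_right (by positivity)).trans hA
          · exact (le_add_of_nonneg_right (by positivity)).trans hW
      _ = thetaProd ‖p‖ ‖a‖ * thetaProd ‖p‖ ‖w‖ * ‖a‖ * ‖p‖ ^ n := by ring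
  · calc ‖p‖ ^ n * ‖a‖ * A * W
        = A * (‖p‖ ^ n * ‖a‖) * (W * (‖p‖ ^ n * ‖w‖)) * (‖p‖ ^ n * ‖w‖)⁻¹ := by field_simp
      _ ≤ thetaProd ‖p‖ ‖a‖ * thetaProd ‖p‖ ‖w‖ * (‖p‖ ^ n * ‖w‖)⁻¹ := by
          gcongr
          · exact (le_add_of_nonneg_left hA0).trans hA
          · exact (le_add_of_nonneg_left hW0).trans hW
      _ = thetaProd ‖p‖ ‖a‖ * thetaProd ‖p‖ ‖w‖ * ‖w‖⁻¹ * ‖p‖ ^ (-n) := by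
          rw [mul_inv, zpow_neg]; ring

lemma differentiableOn_regularSum (hp : ‖p‖ < 1) (hp0 : p ≠ 0) {U : Set ℂ} (hU : IsOpen U)
    {α ω : ℂ → ℂ} (hα : DifferentiableOn ℂ α U) (hω : DifferentiableOn ℂ ω U)
    (hα0 : ∀ z ∈ U, α z ≠ 0) (hω0 : ∀ z ∈ U, ω z ≠ 0) :
    DifferentiableOn ℂ (fun z => regularSum p (α z) (ω z)) U := by
  have hαn := hα.continuousOn.norm
  have hωn := hω.continuousOn.norm
  have hΘ : ContinuousOn (thetaProd ‖p‖) {0}ᶜ := continuousOn_thetaProd (by rwa [norm_norm])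
  refine differentiableOn_tsum_of_norm_le_mul
    (M := fun z => thetaProd ‖p‖ ‖α z‖ * thetaProd ‖p‖ ‖ω z‖ * (‖α z‖ + ‖ω z‖⁻¹)) hU
    (fun n => ?_) ?_ (summable_pow_natAbs (norm_nonneg p) hp) (fun n => by positivity)
    (fun n z hz => norm_regularTerm_le hp hp0 (hα0 z hz) (hω0 z hz) n)
  · exact ((hα.const_mul _).mul ((differentiableOn_thetaDivOneAdd hp hp0 n).comp hα hα0)).mul
      ((differentiableOn_thetaDivQProd hp hp0 n).comp hω hω0)
  · exact ((hΘ.comp hαn fun z hz => norm_ne_zero_iff.mpr (hα0 z hz)).mul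
      (hΘ.comp hωn fun z hz => norm_ne_zero_iff.mpr (hω0 z hz))).mul
      (hαn.add (hωn.inv₀ fun z hz => norm_ne_zero_iff.mpr (hω0 z hz)))

lemma regularSum_eq_mul (hp0 : p ≠ 0) (ha : a ≠ 0) (hw : w ≠ 0) :
    regularSum p a w = a * w * regularSum p (p * a) (p * w) := by
  rw [regularSum, regularSum, ← tsum_mul_left, ← (Equiv.addRight (1 : ℤ)).tsum_eq]
  refine tsum_congr fun n => ?_
  rw [Equiv.coe_addRight, regularTerm, regularTerm, thetaDivOneAdd_add_one hp0 ha,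
    thetaDivQProd_add_one hp0 hw, zpow_add_one₀ hp0]
  ring

lemma isQuasiPeriodic_regularSum (hp : ‖p‖ < 1) (hp0 : p ≠ 0) {t : ℂ} (ht : t ≠ 0) :
    IsQuasiPeriodic p t 2 fun z => regularSum p z (t * z) where
  differentiableOn := differentiableOn_regularSum hp hp0 isOpen_compl_singleton
    differentiableOn_id (differentiableOn_id.const_mul t) (fun _ => id) fun _ => mul_ne_zero ht
  apply_eq z hz := by
    rw [regularSum_eq_mul hp0 hz (mul_ne_zero ht hz), mul_left_comm p t z]
    ring

-- The theta factor `thetaProd p a` vanishes at `a = -1`, so only the term with a pole survives.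
lemma regularSum_neg_one (hp : ‖p‖ < 1) (hp0 : p ≠ 0) (w : ℂ) :
    regularSum p (-1) w = -(qProd p (-p) ^ 2 * qProd p (p / w)) := by
  rw [regularSum, tsum_eq_single 0]
  · simp [regularTerm, thetaDivOneAdd, thetaDivQProd, div_neg, sq]
  · intro n hn
    have hne : 1 + p ^ n * (-1) ≠ 0 := by
      intro h
      have hpow : ‖p‖ ^ n = 1 := by
        rw [← norm_zpow, show p ^ n = 1 by linear_combination -h, norm_one]
      exact hn ((zpow_eq_one_iff_right₀ (norm_nonneg p) hp.ne).mp hpow)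
    have hzero := thetaDivOneAdd_mul_one_add hp hp0 (neg_ne_zero.mpr one_ne_zero) n
    rw [thetaProd_neg_one hp] at hzero
    rw [regularTerm, (mul_eq_zero.mp hzero).resolve_right hne, mul_zero, zero_mul]

lemma regularTerm_eq (hp : ‖p‖ < 1) (hp0 : p ≠ 0) (ha : thetaProd p a ≠ 0)
    (hw : thetaProd p w ≠ 0) (ha0 : a ≠ 0) (hw0 : w ≠ 0) (n : ℤ) :
    regularTerm p a w n = thetaProd p a * thetaProd p w *
      (p ^ n * a / ((1 + p ^ n * a) * qProd p (p ^ n * w))) := by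
  rw [← thetaDivOneAdd_mul_one_add hp hp0 ha0 n] at ha ⊢
  rw [← thetaDivQProd_mul_qProd hp hp0 hw0 n] at hw ⊢
  have hne_a := right_ne_zero_of_mul ha
  have hne_w := right_ne_zero_of_mul hw
  rw [regularTerm]
  field_simp

lemma summable_bilateralSum (hp : ‖p‖ < 1) (hp0 : p ≠ 0) (ha : thetaProd p a ≠ 0)
    (hw : thetaProd p w ≠ 0) (ha0 : a ≠ 0) (hw0 : w ≠ 0) :
    Summable fun n : ℤ => p ^ n * a / ((1 + p ^ n * a) * qProd p (p ^ n * w)) := by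
  have hsum : Summable (regularTerm p a w) :=
    ((summable_pow_natAbs (norm_nonneg p) hp).mul_left _).of_norm_bounded
      (norm_regularTerm_le hp hp0 ha0 hw0)
  rw [funext (regularTerm_eq hp hp0 ha hw ha0 hw0)] at hsum
  exact (summable_mul_left_iff (mul_ne_zero ha hw)).mp hsum

lemma regularSum_eq_mul_bilateralSum (hp : ‖p‖ < 1) (hp0 : p ≠ 0) (ha : thetaProd p a ≠ 0)
    (hw : thetaProd p w ≠ 0) (ha0 : a ≠ 0) (hw0 : w ≠ 0) :
    regularSum p a w = thetaProd p a * thetaProd p w * bilateralSum p a w := by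
  simp only [regularSum, bilateralSum, regularTerm_eq hp hp0 ha hw ha0 hw0, tsum_mul_left]

lemma continuousAt_bilateralSum (hp : ‖p‖ < 1) (hp0 : p ≠ 0) (ha : thetaProd p a ≠ 0)
    (hw : thetaProd p w ≠ 0) (ha0 : a ≠ 0) (hw0 : w ≠ 0) :
    ContinuousAt (bilateralSum p a) w := by
  have hmem : ({0}ᶜ : Set ℂ) ∈ 𝓝 w := isOpen_compl_singleton.mem_nhds hw0
  have hΘ := (continuousOn_thetaProd hp).continuousAt hmem
  have hR : ContinuousAt (regularSum p a) w :=
    (differentiableOn_regularSum hp hp0 isOpen_compl_singleton (differentiableOn_const a)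
      differentiableOn_id (fun _ _ => ha0) fun _ => id).continuousOn.continuousAt hmem
  refine (hR.div (continuousAt_const.mul hΘ) (mul_ne_zero ha hw)).congr ?_
  filter_upwards [hmem, hΘ.eventually_ne hw] with z hz0 hz
  exact (div_eq_iff (mul_ne_zero ha hz)).mpr
    ((regularSum_eq_mul_bilateralSum hp hp0 ha hz ha0 hz0).trans (mul_comm _ _))

end BilateralSum

section ConnectionFormula

variable {p : ℂ}

lemma isQuasiPeriodic_thetaProd_mul_thetaProd (hp : ‖p‖ < 1) (hp0 : p ≠ 0) {α β : ℂ}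
    (hα : α ≠ 0) (hβ : β ≠ 0) :
    IsQuasiPeriodic p (α * β) 2 fun z => thetaProd p (α * z) * thetaProd p (β * z) where
  differentiableOn :=
    ((differentiableOn_thetaProd hp).comp (differentiableOn_id.const_mul α)
      fun _ => mul_ne_zero hα).mul
    ((differentiableOn_thetaProd hp).comp (differentiableOn_id.const_mul β)
      fun _ => mul_ne_zero hβ)
  apply_eq z hz := by
    rw [thetaProd_eq_mul hp hp0 (mul_ne_zero hα hz), thetaProd_eq_mul hp hp0 (mul_ne_zero hβ hz),
      mul_left_comm p α z, mul_left_comm p β z]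
    ring

lemma qProd_mul_regularSum_neg_one (hp : ‖p‖ < 1) (hp0 : p ≠ 0) (t : ℂ) :
    qProd p (-t) * regularSum p (-1) (-t) = -(qProd p (-p) ^ 2 * thetaProd p (-t)) := by
  rw [regularSum_neg_one hp hp0, thetaProd]
  ring

-- Interpolation at the nodes `b` and `-1`: the two theta products vanish at `-1` and at `b`
-- respectively.
lemma regularSum_eq_interpolation (hp : ‖p‖ < 1) (hp0 : p ≠ 0) {b t z : ℂ}
    (hb : thetaProd p b ≠ 0) (htb : thetaProd p (t * b) ≠ 0) (hb0 : b ≠ 0) (ht0 : t ≠ 0)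
    (hz : z ≠ 0) :
    regularSum p z (t * z) =
      regularSum p b (t * b) / (thetaProd p b * thetaProd p (t * b)) *
          (thetaProd p z * thetaProd p (t * z)) +
        regularSum p (-1) (-t) / (thetaProd p (p * b) * thetaProd p (t * b)) *
          (thetaProd p (-(z / b)) * thetaProd p (-(t * z * b))) := by
  have hpb : thetaProd p b⁻¹ ≠ 0 := by
    rw [← thetaProd_mul_eq_inv hp0]
    exact right_ne_zero_of_mul (thetaProd_eq_mul hp hp0 hb0 ▸ hb)
  have hF₁ : IsQuasiPeriodic p t 2 fun z => thetaProd p z * thetaProd p (t * z) := by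
    simpa only [one_mul] using isQuasiPeriodic_thetaProd_mul_thetaProd hp hp0 one_ne_zero ht0
  have hF₂ : IsQuasiPeriodic p t 2 fun z =>
      thetaProd p (-(z / b)) * thetaProd p (-(t * z * b)) := by
    convert isQuasiPeriodic_thetaProd_mul_thetaProd hp hp0
      (neg_ne_zero.mpr (inv_ne_zero hb0)) (neg_ne_zero.mpr (mul_ne_zero ht0 hb0)) using 4
    · field_simp
    · ring
    · ring
  have hinterp := IsQuasiPeriodic.eq_sum_interpolation (ι := Fin 2) (x := ![b, -1])
    (F := ![fun z => thetaProd p z * thetaProd p (t * z),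
      fun z => thetaProd p (-(z / b)) * thetaProd p (-(t * z * b))])
    (isQuasiPeriodic_regularSum hp hp0 ht0) (Fin.forall_fin_two.mpr ⟨hF₁, hF₂⟩) hp0
    (by simp [Fin.forall_fin_two, hb0])
    (by simp [Fin.forall_fin_two, hb, htb, hpb, hb0, neg_div, thetaProd_neg_one hp]) hz
  simpa [Fin.sum_univ_two, neg_div, thetaProd_mul_eq_inv hp0] using hinterp

theorem qProd_mul_bilateralSum_sub (hp : ‖p‖ < 1) (hp0 : p ≠ 0) {a b t : ℂ}
    (ha : thetaProd p a ≠ 0) (hb : thetaProd p b ≠ 0) (hta : thetaProd p (t * a) ≠ 0)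
    (htb : thetaProd p (t * b) ≠ 0) (ha0 : a ≠ 0) (hb0 : b ≠ 0) (ht0 : t ≠ 0) :
    qProd p (-t) * (bilateralSum p a (t * a) - bilateralSum p b (t * b)) =
      -qProd p (-p) ^ 2 *
        (thetaProd p (-(a / b)) * thetaProd p (-t) * thetaProd p (-(t * a * b))) /
        (thetaProd p a * thetaProd p (p * b) * thetaProd p (t * a) * thetaProd p (t * b)) := by
  have hpb : thetaProd p (p * b) ≠ 0 :=
    right_ne_zero_of_mul (thetaProd_eq_mul hp hp0 hb0 ▸ hb)
  have hinterp := regularSum_eq_interpolation hp hp0 hb htb hb0 ht0 ha0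
  rw [regularSum_eq_mul_bilateralSum hp hp0 ha hta ha0 (mul_ne_zero ht0 ha0),
    regularSum_eq_mul_bilateralSum hp hp0 hb htb hb0 (mul_ne_zero ht0 hb0),
    mul_div_cancel_left₀ _ (mul_ne_zero hb htb)] at hinterp
  have hnode := qProd_mul_regularSum_neg_one hp hp0 t
  generalize thetaProd p (p * b) = Θ at hinterp hpb ⊢
  field_simp at hinterp ⊢
  linear_combination qProd p (-t) * hinterp +
    thetaProd p (-(a / b)) * thetaProd p (-(t * a * b)) * hnode

end ConnectionFormula

section JacksonIntegral

lemma tendsto_tsum_nat_add_atBot {E : Type*} [NormedAddCommGroup E] [CompleteSpace E] {u : ℤ → E}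
    (hu : Summable fun n => ‖u n‖) :
    Tendsto (fun k : ℤ => ∑' m : ℕ, u (m + k)) atBot (𝓝 (∑' n, u n)) := by
  have htail (k : ℤ) : ∑' m : ℕ, u (m + k) = ∑' n, (Set.Ici k).indicator u n := by
    have hinj : Function.Injective fun m : ℕ => (m : ℤ) + k := fun m n h => by simpa using h
    rw [← hinj.tsum_eq]
    · exact tsum_congr fun m => by simp
    · intro n hn
      have hkn : k ≤ n := Set.mem_of_indicator_ne_zero (s := Set.Ici k) (f := u) hn
      exact ⟨(n - k).toNat, by simp [hkn]⟩
  simp only [htail]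
  refine tendsto_tsum_of_dominated_convergence hu (fun n => tendsto_const_nhds.congr' ?_)
    (Eventually.of_forall fun k n => norm_indicator_le_norm_self u n)
  filter_upwards [eventually_le_atBot n] with k hk
  exact (Set.indicator_of_mem (s := Set.Ici k) hk u).symm

lemma hasSpiralIntegral_tsum {p : ℝ} (hp : p ≠ 0) {f : ℂ → ℂ} {α : ℂ} (hα : α ≠ 0)
    (hf : Summable fun n : ℤ => f ((p : ℂ) ^ n * α) * ((p : ℂ) ^ n * α)) :
    HasSpiralIntegral p f α ((1 - p) * ∑' n : ℤ, f ((p : ℂ) ^ n * α) * ((p : ℂ) ^ n * α)) := by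
  have hpC : (p : ℂ) ≠ 0 := Complex.ofReal_ne_zero.mpr hp
  set u : ℤ → ℂ := fun n => f ((p : ℂ) ^ n * α) * ((p : ℂ) ^ n * α) with hu
  have hy (k : ℤ) : (p : ℂ) ^ k * α ≠ 0 := mul_ne_zero (zpow_ne_zero k hpC) hα
  have hshift (k : ℤ) (m : ℕ) : u (m + k) =
      (p : ℂ) ^ k * α * (f ((p : ℂ) ^ m * ((p : ℂ) ^ k * α)) * (p : ℂ) ^ m) := by
    simp only [hu]
    rw [zpow_add₀ hpC, zpow_natCast, mul_assoc ((p : ℂ) ^ m)]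
    ring
  constructor
  · intro k
    have hsum : Summable fun m : ℕ => u (m + k) :=
      hf.comp_injective ((add_left_injective k).comp Nat.cast_injective)
    simp only [hshift] at hsum
    exact (summable_mul_left_iff (hy k)).mp hsum
  · refine ((tendsto_tsum_nat_add_atBot hf.norm).const_mul (1 - (p : ℂ))).congr fun k => ?_
    simp only [hshift]
    rw [tsum_mul_left, jacksonIntegral, mul_assoc (1 - (p : ℂ))]

end JacksonIntegral

section DiscreteSum

/-- The constant `C` of the connection formula `discreteSum_sub_eq`. Its last factor is the ratio
between the theta series and the product `thetaProd`. -/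
def connectionConstant (q : ℝ) : ℂ :=
  -(q * (1 - (q : ℂ)⁻¹) * qProd (q : ℂ)⁻¹ (-(q : ℂ)⁻¹) ^ 2 *
    (theta q⁻¹ 1 / thetaProd (q : ℂ)⁻¹ 1))

variable {q : ℝ} {lam mu x : ℂ}

lemma qExp_eq_qProd (q : ℝ) (z : ℂ) : qExp q z = qProd (q : ℂ)⁻¹ ((1 - (q : ℂ)⁻¹) * z) :=
  tprod_congr fun k => by ring

lemma ofReal_ne_zero_of_one_lt (hq : 1 < q) : (q : ℂ) ≠ 0 :=
  Complex.ofReal_ne_zero.mpr (zero_lt_one.trans hq).ne'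

lemma one_sub_inv_ne_zero_of_one_lt (hq : 1 < q) : 1 - (q : ℂ)⁻¹ ≠ 0 := by
  rw [sub_ne_zero, ne_comm, Ne, inv_eq_one]
  exact_mod_cast hq.ne'

lemma norm_inv_lt_one_of_one_lt (hq : 1 < q) : ‖(q : ℂ)⁻¹‖ < 1 := by
  rw [norm_inv, Complex.norm_real, Real.norm_of_nonneg (zero_lt_one.trans hq).le]
  exact inv_lt_one_of_one_lt₀ hq

lemma thetaProd_inv_div_ne_zero (hq : 1 < q) {α β : ℂ} (hα : α ≠ 0) (hβ : β ≠ 0)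
    (h : ∀ n : ℤ, α ≠ -(β * (q : ℂ) ^ n)) : thetaProd (q : ℂ)⁻¹ (α / β) ≠ 0 := by
  have hq0 := ofReal_ne_zero_of_one_lt hq
  refine thetaProd_ne_zero (norm_inv_lt_one_of_one_lt hq) (inv_ne_zero hq0)
    (div_ne_zero hα hβ) fun n hn => h n ?_
  have hqn : (q : ℂ) ^ n ≠ 0 := zpow_ne_zero n hq0
  rw [inv_zpow] at hn
  field_simp at hn
  linear_combination hn

lemma thetaProd_inv_mul_div_ne_zero (hq : 1 < q) (hlam : lam ≠ 0) (hx : x ≠ 0)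
    (h : ∀ n : ℤ, x ≠ -(lam * (q : ℂ) ^ n)) : thetaProd (q : ℂ)⁻¹ (q * lam / x) ≠ 0 := by
  have hq0 := ofReal_ne_zero_of_one_lt hq
  refine thetaProd_inv_div_ne_zero hq (mul_ne_zero hq0 hlam) hx fun n hn => h (1 - n) ?_
  have hqn : (q : ℂ) ^ n ≠ 0 := zpow_ne_zero n hq0
  rw [zpow_sub₀ hq0, zpow_one]
  field_simp
  linear_combination hn

lemma integrand_mul_self (hq : 1 < q) (x ξ : ℂ) :
    integrand q x ξ * ξ = (1 - (q : ℂ)⁻¹) * (ξ / (1 - (q : ℂ)⁻¹) /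
      ((1 + ξ / (1 - (q : ℂ)⁻¹)) * qProd (q : ℂ)⁻¹ (q * ξ / x))) := by
  have hd := one_sub_inv_ne_zero_of_one_lt hq
  have harg : (1 - (q : ℂ)⁻¹) * (q * (ξ / ((1 - (q : ℂ)⁻¹) * x))) = q * ξ / x := by
    rw [mul_left_comm, mul_div_assoc', mul_div_mul_left _ _ hd, mul_div_assoc]
  rw [integrand, psi, qExp_eq_qProd, harg, mul_div_assoc', mul_div_cancel₀ _ hd, div_div,
    one_div_mul_eq_div]

lemma integrand_zpow_mul_self (hq : 1 < q) (lam x : ℂ) (n : ℤ) :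
    integrand q x ((q⁻¹ : ℝ) ^ n * lam) * ((q⁻¹ : ℝ) ^ n * lam) =
      (1 - (q : ℂ)⁻¹) * ((q : ℂ)⁻¹ ^ n * (lam / (1 - (q : ℂ)⁻¹)) /
        ((1 + (q : ℂ)⁻¹ ^ n * (lam / (1 - (q : ℂ)⁻¹))) *
          qProd (q : ℂ)⁻¹ ((q : ℂ)⁻¹ ^ n * (q * lam / x)))) := by
  rw [integrand_mul_self hq, Complex.ofReal_inv, mul_left_comm (q : ℂ), mul_div_assoc _ lam,
    mul_div_assoc _ (q * lam)]

lemma hasSpiralIntegral_integrand (hq : 1 < q) (hlam : lam ≠ 0) (hx : x ≠ 0)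
    (hl : thetaProd (q : ℂ)⁻¹ (lam / (1 - (q : ℂ)⁻¹)) ≠ 0)
    (hlx : thetaProd (q : ℂ)⁻¹ (q * lam / x) ≠ 0) :
    HasSpiralIntegral q⁻¹ (integrand q x) lam ((1 - (q : ℂ)⁻¹) * ((1 - (q : ℂ)⁻¹) *
      bilateralSum (q : ℂ)⁻¹ (lam / (1 - (q : ℂ)⁻¹)) (q * lam / x))) := by
  have hq0 := ofReal_ne_zero_of_one_lt hq
  have hsum := summable_bilateralSum (norm_inv_lt_one_of_one_lt hq) (inv_ne_zero hq0) hl hlx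
    (div_ne_zero hlam (one_sub_inv_ne_zero_of_one_lt hq)) (div_ne_zero (mul_ne_zero hq0 hlam) hx)
  have hspiral := hasSpiralIntegral_tsum (inv_ne_zero (zero_lt_one.trans hq).ne')
    (f := integrand q x) hlam (by
      simpa only [integrand_zpow_mul_self hq] using hsum.mul_left (1 - (q : ℂ)⁻¹))
  simp only [integrand_zpow_mul_self hq, tsum_mul_left] at hspiral
  rwa [Complex.ofReal_inv] at hspiral

lemma discreteSum_eq_mul_bilateralSum (hq : 1 < q) (hlam : lam ≠ 0) (hx : x ≠ 0)
    (hl : thetaProd (q : ℂ)⁻¹ (lam / (1 - (q : ℂ)⁻¹)) ≠ 0)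
    (hlx : thetaProd (q : ℂ)⁻¹ (q * lam / x) ≠ 0) :
    discreteSum q lam x = q * (1 - (q : ℂ)⁻¹) *
      bilateralSum (q : ℂ)⁻¹ (lam / (1 - (q : ℂ)⁻¹)) (q * lam / x) := by
  have hd := one_sub_inv_ne_zero_of_one_lt hq
  rw [discreteSum, spiralIntegral, (hasSpiralIntegral_integrand hq hlam hx hl hlx).2.limUnder_eq,
    ← mul_assoc, div_mul_cancel₀ _ hd, mul_assoc]

lemma mul_thetaQuotient_eq (hq : 1 < q) {a b : ℂ} (ha : a ≠ 0) (hb : b ≠ 0) (hx : x ≠ 0) :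
    theta q⁻¹ 1 / thetaProd (q : ℂ)⁻¹ 1 * thetaQuotient q a b x =
      (thetaProd (q : ℂ)⁻¹ (-(a / b)) * thetaProd (q : ℂ)⁻¹ (-(q * (1 - (q : ℂ)⁻¹) / x)) *
          thetaProd (q : ℂ)⁻¹ (-(q * (1 - (q : ℂ)⁻¹) / x * a * b))) /
        (thetaProd (q : ℂ)⁻¹ a * thetaProd (q : ℂ)⁻¹ ((q : ℂ)⁻¹ * b) *
          thetaProd (q : ℂ)⁻¹ (q * (1 - (q : ℂ)⁻¹) / x * a) *
          thetaProd (q : ℂ)⁻¹ (q * (1 - (q : ℂ)⁻¹) / x * b)) := by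
  have hq0 := ofReal_ne_zero_of_one_lt hq
  have hp0 : 0 < q⁻¹ := inv_pos.mpr (zero_lt_one.trans hq)
  have hp1 : q⁻¹ < 1 := inv_lt_one_of_one_lt₀ hq
  have hκ0 : theta q⁻¹ 1 / thetaProd (q : ℂ)⁻¹ 1 ≠ 0 := fun h =>
    theta_one_ne_zero hp0 hp1 <| by
      rw [theta_eq_mul_thetaProd hp0 hp1 one_ne_zero, Complex.ofReal_inv, h, zero_mul]
  have htheta {z : ℂ} (hz : z ≠ 0) : theta q⁻¹ z =
      theta q⁻¹ 1 / thetaProd (q : ℂ)⁻¹ 1 * thetaProd (q : ℂ)⁻¹ z := by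
    simpa using theta_eq_mul_thetaProd hp0 hp1 hz
  have hshift {z : ℂ} (hz : z ≠ 0) : theta q⁻¹ z =
      theta q⁻¹ 1 / thetaProd (q : ℂ)⁻¹ 1 * (thetaProd (q : ℂ)⁻¹ (q * z) / (q * z)) := by
    rw [htheta hz, thetaProd_eq_mul (norm_inv_lt_one_of_one_lt hq) (inv_ne_zero hq0)
      (mul_ne_zero hq0 hz), inv_mul_cancel_left₀ hq0, mul_div_cancel_left₀ _ (mul_ne_zero hq0 hz)]
  have ht0 := div_ne_zero (one_sub_inv_ne_zero_of_one_lt hq) hx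
  rw [thetaQuotient, mul_assoc _ a b, mul_div_right_comm _ a, mul_div_right_comm _ b,
    mul_div_right_comm _ (a * b), mul_div_assoc (q : ℂ)]
  generalize (1 - (q : ℂ)⁻¹) / x = t at ht0 ⊢
  rw [htheta (neg_ne_zero.mpr (div_ne_zero ha hb)), hshift (neg_ne_zero.mpr ht0),
    hshift (neg_ne_zero.mpr (mul_ne_zero ht0 (mul_ne_zero ha hb))), htheta ha,
    htheta (mul_ne_zero (inv_ne_zero hq0) hb), hshift (mul_ne_zero ht0 ha),
    hshift (mul_ne_zero ht0 hb)]
  generalize theta q⁻¹ 1 / thetaProd (q : ℂ)⁻¹ 1 = κ at hκ0 ⊢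
  simp only [mul_neg, ← mul_assoc]
  field_simp

theorem discreteSum_sub_eq (hq : 1 < q) (hlam : lam ≠ 0) (hmu : mu ≠ 0) (hx : x ≠ 0)
    (hl : thetaProd (q : ℂ)⁻¹ (lam / (1 - (q : ℂ)⁻¹)) ≠ 0)
    (hm : thetaProd (q : ℂ)⁻¹ (mu / (1 - (q : ℂ)⁻¹)) ≠ 0)
    (hlx : thetaProd (q : ℂ)⁻¹ (q * lam / x) ≠ 0) (hmx : thetaProd (q : ℂ)⁻¹ (q * mu / x) ≠ 0)
    (hE : qExp q (-(q / x)) ≠ 0) :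
    discreteSum q lam x - discreteSum q mu x = connectionConstant q *
      thetaQuotient q (lam / (1 - (q : ℂ)⁻¹)) (mu / (1 - (q : ℂ)⁻¹)) x / qExp q (-(q / x)) := by
  have hq0 := ofReal_ne_zero_of_one_lt hq
  have hd := one_sub_inv_ne_zero_of_one_lt hq
  have ha0 := div_ne_zero hlam hd
  have hb0 := div_ne_zero hmu hd
  have harg (ν : ℂ) : q * ν / x = q * (1 - (q : ℂ)⁻¹) / x * (ν / (1 - (q : ℂ)⁻¹)) := by
    rw [div_mul_div_comm, mul_right_comm, mul_div_mul_right _ _ hd]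
  have hexp : qExp q (-(q / x)) = qProd (q : ℂ)⁻¹ (-(q * (1 - (q : ℂ)⁻¹) / x)) := by
    rw [qExp_eq_qProd]
    congr 1
    ring
  rw [discreteSum_eq_mul_bilateralSum hq hlam hx hl hlx,
    discreteSum_eq_mul_bilateralSum hq hmu hx hm hmx, eq_div_iff hE, hexp, harg lam, harg mu]
  rw [harg] at hlx hmx
  have hconn := qProd_mul_bilateralSum_sub (norm_inv_lt_one_of_one_lt hq) (inv_ne_zero hq0)
    hl hm hlx hmx ha0 hb0 (div_ne_zero (mul_ne_zero hq0 hd) hx)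
  rw [mul_div_assoc (-qProd (q : ℂ)⁻¹ (-(q : ℂ)⁻¹) ^ 2),
    ← mul_thetaQuotient_eq hq ha0 hb0 hx] at hconn
  rw [connectionConstant]
  linear_combination q * (1 - (q : ℂ)⁻¹) * hconn

lemma eventually_thetaProd_inv_mul_div_ne_zero (hq : 1 < q) (hlam : lam ≠ 0) (hx : x ≠ 0)
    (hlx : thetaProd (q : ℂ)⁻¹ (q * lam / x) ≠ 0) :
    ∀ᶠ z in 𝓝 x, thetaProd (q : ℂ)⁻¹ (q * lam / z) ≠ 0 := by
  have hw0 := div_ne_zero (mul_ne_zero (ofReal_ne_zero_of_one_lt hq) hlam) hx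
  have hΘ : ContinuousAt (thetaProd (q : ℂ)⁻¹) (q * lam / x) :=
    (continuousOn_thetaProd (norm_inv_lt_one_of_one_lt hq)).continuousAt
      (isOpen_compl_singleton.mem_nhds hw0)
  have hdiv : ContinuousAt (fun z => q * lam / z) x := continuousAt_const.div continuousAt_id hx
  exact (ContinuousAt.comp' hΘ hdiv).eventually_ne hlx

lemma continuousAt_discreteSum (hq : 1 < q) (hlam : lam ≠ 0) (hx : x ≠ 0)
    (hl : thetaProd (q : ℂ)⁻¹ (lam / (1 - (q : ℂ)⁻¹)) ≠ 0)
    (hlx : thetaProd (q : ℂ)⁻¹ (q * lam / x) ≠ 0) : ContinuousAt (discreteSum q lam) x := by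
  have hq0 := ofReal_ne_zero_of_one_lt hq
  have hdiv : ContinuousAt (fun z => q * lam / z) x := continuousAt_const.div continuousAt_id hx
  have hS := continuousAt_bilateralSum (norm_inv_lt_one_of_one_lt hq) (inv_ne_zero hq0) hl hlx
    (div_ne_zero hlam (one_sub_inv_ne_zero_of_one_lt hq)) (div_ne_zero (mul_ne_zero hq0 hlam) hx)
  refine ((ContinuousAt.comp' hS hdiv).const_mul (q * (1 - (q : ℂ)⁻¹))).congr ?_
  filter_upwards [eventually_ne_nhds hx,
    eventually_thetaProd_inv_mul_div_ne_zero hq hlam hx hlx] with z hz0 hz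
  exact (discreteSum_eq_mul_bilateralSum hq hlam hz0 hl hz).symm

lemma eventually_qExp_ne_zero (hq : 1 < q) (hx : x ≠ 0) :
    ∀ᶠ z in 𝓝[≠] x, qExp q (-(q / z)) ≠ 0 := by
  have hdiff : Differentiable ℂ (qExp q) := by
    rw [funext (qExp_eq_qProd q)]
    exact (differentiable_qProd (norm_inv_lt_one_of_one_lt hq)).comp (differentiable_id.const_mul _)
  have hne : ∀ᶠ w in 𝓝[≠] (-(q / x)), qExp q w ≠ 0 := by
    have hanalytic : AnalyticOnNhd ℂ (qExp q) Set.univ := fun w _ => hdiff.analyticAt w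
    refine (hdiff.analyticAt _).eventually_eq_zero_or_eventually_ne_zero.resolve_left fun h => ?_
    have hzero := hanalytic.eqOn_zero_of_preconnected_of_eventuallyEq_zero isPreconnected_univ
      (Set.mem_univ _) h (Set.mem_univ 0)
    simp [qExp_eq_qProd, qProd_zero] at hzero
  have hcont : ContinuousAt (fun z : ℂ => -(q / z)) x :=
    (continuousAt_const.div continuousAt_id hx).neg
  refine (hcont.tendsto.inf ?_).eventually hne
  refine tendsto_principal_principal.mpr fun z hz h => hz ?_
  simpa [div_eq_mul_inv, ofReal_ne_zero_of_one_lt hq] using h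

end DiscreteSum

end QEuler

end

theorem mainTheorem10 (q : ℝ) (hq : 1 < q) :
    ∃ C : ℂ, ∀ lam mu : ℂ, lam ≠ 0 → mu ≠ 0 →
      (∀ n : ℤ, lam ≠ -((1 - (q : ℂ)⁻¹) * (q : ℂ) ^ n)) →
      (∀ n : ℤ, mu ≠ -((1 - (q : ℂ)⁻¹) * (q : ℂ) ^ n)) →
      ∀ x : ℂ, x ≠ 0 →
        (∀ n : ℤ, x ≠ -(lam * (q : ℂ) ^ n)) → (∀ n : ℤ, x ≠ -(mu * (q : ℂ) ^ n)) →
        QEuler.DiscreteSumConverges q lam x ∧ QEuler.DiscreteSumConverges q mu x ∧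
        (QEuler.qExp q (-(q / x)) ≠ 0 →
          QEuler.discreteSum q lam x - QEuler.discreteSum q mu x =
            C * QEuler.thetaQuotient q (lam / (1 - (q : ℂ)⁻¹)) (mu / (1 - (q : ℂ)⁻¹)) x /
              QEuler.qExp q (-(q / x))) ∧
        Filter.Tendsto
          (fun z : ℂ =>
            C * QEuler.thetaQuotient q (lam / (1 - (q : ℂ)⁻¹)) (mu / (1 - (q : ℂ)⁻¹)) z /
              QEuler.qExp q (-(q / z)))
          (nhdsWithin x {x}ᶜ)
          (nhds (QEuler.discreteSum q lam x - QEuler.discreteSum q mu x)) := by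
  refine ⟨QEuler.connectionConstant q, fun lam mu hlam hmu hl hm x hx hlx hmx => ?_⟩
  have hd := QEuler.one_sub_inv_ne_zero_of_one_lt hq
  replace hl := QEuler.thetaProd_inv_div_ne_zero hq hlam hd hl
  replace hm := QEuler.thetaProd_inv_div_ne_zero hq hmu hd hm
  replace hlx := QEuler.thetaProd_inv_mul_div_ne_zero hq hlam hx hlx
  replace hmx := QEuler.thetaProd_inv_mul_div_ne_zero hq hmu hx hmx
  refine ⟨⟨_, QEuler.hasSpiralIntegral_integrand hq hlam hx hl hlx⟩,
    ⟨_, QEuler.hasSpiralIntegral_integrand hq hmu hx hm hmx⟩,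
    QEuler.discreteSum_sub_eq hq hlam hmu hx hl hm hlx hmx, ?_⟩
  have hcont := (QEuler.continuousAt_discreteSum hq hlam hx hl hlx).sub
    (QEuler.continuousAt_discreteSum hq hmu hx hm hmx)
  refine (hcont.tendsto.mono_left nhdsWithin_le_nhds).congr' ?_
  filter_upwards [nhdsWithin_le_nhds (eventually_ne_nhds hx), QEuler.eventually_qExp_ne_zero hq hx,
    nhdsWithin_le_nhds (QEuler.eventually_thetaProd_inv_mul_div_ne_zero hq hlam hx hlx),
    nhdsWithin_le_nhds (QEuler.eventually_thetaProd_inv_mul_div_ne_zero hq hmu hx hmx)]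
    with z hz hE hlz hmz
  exact QEuler.discreteSum_sub_eq hq hlam hmu hz hl hm hlz hmz hE
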